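/- Let $K$ be a subfield of $\mathbb{R}$, regarded as an ordered field with the order induced from $\mathbb{R}$. Let $\alpha,\beta\in K$ with $\alpha,\beta>0$, $\alpha\neq 1$ and $\log_\alpha\beta\notin\mathbb{Q}$, and write $\alpha^{\mathbb{Z}}=\{\alpha^k:k\in\mathbb{Z}\}$ and $\beta^{\mathbb{Z}}=\{\beta^k:k\in\mathbb{Z}\}$. Then the structure $(K,\alpha^{\mathbb{Z}},\beta^{\mathbb{Z}})$, that is, the ordered field $(K,+,\cdot,-,0,1,\le)$ expanded by unary predicates for the sets $\alpha^{\mathbb{Z}}$ and $\beta^{\mathbb{Z}}$, defines $\mathbb{Z}$: there is a first-order formula in one free variable in the language of this structure, with parameters from $K$, whose set of solutions in $K$ is exactly $\mathbb{Z}$. -/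

import Mathlib

namespace SubfieldExpansion

open FirstOrder

/-- Two unary predicate symbols. -/
inductive TwoPredRel : ℕ → Type
  | fst : TwoPredRel 1
  | snd : TwoPredRel 1

/-- The relational language consisting of two unary predicate symbols. -/
def twoPred : Language := ⟨fun _ => Empty, TwoPredRel⟩

/-- The language of ordered rings `(+, *, -, 0, 1, ≤)` together with two unary predicates. -/
abbrev orderedRingTwoPred : Language := (Language.ring.sum Language.order).sum twoPred

/-- The interpretation of the two predicate symbols by the sets `A` and `B`. -/
@[reducible]
def twoPredStructure {M : Type} (A B : Set M) : twoPred.Structure M where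
  funMap f := nomatch f
  RelMap
    | .fst => fun x => x 0 ∈ A
    | .snd => fun x => x 0 ∈ B

/-- The expansion `(K, A, B)` of the ordered field `K`, a subfield of `ℝ` with the induced
operations and the induced order, by predicates for the subsets `A` and `B` of `K`. -/
@[reducible]
noncomputable def expansion (K : Subfield ℝ) (A B : Set K) : orderedRingTwoPred.Structure K :=
  letI := Ring.compatibleRingOfRing K
  letI := Language.orderStructure K
  letI := twoPredStructure A B
  inferInstance

/-- `(K, A, B)` defines `S ⊆ K`: some first-order formula in one free variable, with parameters
from `K`, has solution set `S` in the structure `(K, A, B)`. -/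
def Defines (K : Subfield ℝ) (A B S : Set K) : Prop :=
  letI := expansion K A B
  (Set.univ : Set K).Definable₁ orderedRingTwoPred S

/-- The set `α^ℤ = {α ^ k : k ∈ ℤ}`. -/
def integerPowers {K : Subfield ℝ} (α : K) : Set K := Set.range fun k : ℤ => α ^ k

end SubfieldExpansion

/-! After inverting if necessary, α, β > 1. Modulo α^ℤ, the power β^m has a representative R_m in
[1, α) (`residue`), and irrationality makes these dense. A pair δ, c in K codes a finite sequence:
each m ≥ 1 with c in (R_m - δ/β^m, R_m) receives the value v = (δ/β^m)/(R_m - c) > 1. The element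
β^m stands for m, so consecutive values can be compared in first-order terms. Then x is a natural
number iff, for every ε > 0, some such sequence runs from about 2 (values must exceed 1) to about x
+ 2 in steps of about 1.

Soundness (`CountsTo.exists_nat`): the number of steps is not bounded in advance, so each step is
allowed only the error ε(1/v - 1/v'), which telescopes. Hence x is within 3ε of ℕ, and ℕ is closed
in ℝ.

Completeness (`exists_codesUpTo`): c is found by nested intervals, each prescribing one more value.
No unwanted value may appear in between: exponents shortly after the current one are excluded by
separation of residues (`exists_le_abs_residue_sub`), later ones by a disjointness argument
(`exists_Ioo_disjoint_of_lt`). Both δ and c can be taken rational, hence in K. -/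

namespace SubfieldExpansion

open FirstOrder FirstOrder.Language

/-! ### Closure properties of definable conditions. -/

section Definability

variable {K : Subfield ℝ} {A B : Set K}

/-- A function of an assignment of the variables is given by a term with parameters. -/
def IsTerm (A B : Set K) (t : (ℕ → K) → K) : Prop :=
  letI := expansion K A B
  ∃ τ : (orderedRingTwoPred[[(Set.univ : Set K)]]).Term ℕ, ∀ x, τ.realize x = t x

/-- A property of an assignment of the variables is given by a formula with parameters. -/
def IsFormula (A B : Set K) (P : (ℕ → K) → Prop) : Prop :=
  letI := expansion K A B
  ∃ φ : (orderedRingTwoPred[[(Set.univ : Set K)]]).Formula ℕ, ∀ x, φ.Realize x ↔ P x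

theorem IsTerm.var (i : ℕ) : IsTerm A B fun x => x i :=
  ⟨.var i, fun _ => rfl⟩

theorem IsTerm.const (a : K) : IsTerm A B fun _ => a := by
  let _ := expansion K A B
  refine ⟨Constants.term (orderedRingTwoPred.con (⟨a, trivial⟩ : (Set.univ : Set K))), fun x => ?_⟩
  rw [Term.realize_constants]
  simp

theorem IsTerm.apply₂ (f : (orderedRingTwoPred[[(Set.univ : Set K)]]).Functions 2)
    {s t : (ℕ → K) → K} (hs : IsTerm A B s) (ht : IsTerm A B t) :
    letI := expansion K A B
    IsTerm A B fun x => Structure.funMap f ![s x, t x] := by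
  let _ := expansion K A B
  obtain ⟨σ, hσ⟩ := hs
  obtain ⟨τ, hτ⟩ := ht
  exact ⟨f.apply₂ σ τ, fun x => by rw [Term.realize_functions_apply₂, hσ, hτ]⟩

theorem IsTerm.add {s t : (ℕ → K) → K} (hs : IsTerm A B s) (ht : IsTerm A B t) :
    IsTerm A B fun x => s x + t x :=
  hs.apply₂ (Sum.inl (Sum.inl (Sum.inl Ring.addFunc))) ht

theorem IsTerm.mul {s t : (ℕ → K) → K} (hs : IsTerm A B s) (ht : IsTerm A B t) :
    IsTerm A B fun x => s x * t x :=
  hs.apply₂ (Sum.inl (Sum.inl (Sum.inl Ring.mulFunc))) ht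

theorem IsTerm.neg {t : (ℕ → K) → K} (ht : IsTerm A B t) : IsTerm A B fun x => -t x := by
  simpa using (IsTerm.const (-1)).mul ht

theorem IsTerm.sub {s t : (ℕ → K) → K} (hs : IsTerm A B s) (ht : IsTerm A B t) :
    IsTerm A B fun x => s x - t x := by
  simpa [sub_eq_add_neg] using hs.add ht.neg

theorem IsFormula.eq {s t : (ℕ → K) → K} (hs : IsTerm A B s) (ht : IsTerm A B t) :
    IsFormula A B fun x => s x = t x := by
  let _ := expansion K A B
  obtain ⟨σ, hσ⟩ := hs
  obtain ⟨τ, hτ⟩ := ht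
  exact ⟨σ.equal τ, fun x => by rw [Formula.realize_equal, hσ, hτ]⟩

theorem IsFormula.rel₁ (R : (orderedRingTwoPred[[(Set.univ : Set K)]]).Relations 1)
    {t : (ℕ → K) → K} (ht : IsTerm A B t) :
    letI := expansion K A B
    IsFormula A B fun x => Structure.RelMap R ![t x] := by
  let _ := expansion K A B
  obtain ⟨τ, hτ⟩ := ht
  exact ⟨R.formula₁ τ, fun x => by rw [Formula.realize_rel₁, hτ]⟩

theorem IsFormula.rel₂ (R : (orderedRingTwoPred[[(Set.univ : Set K)]]).Relations 2)
    {s t : (ℕ → K) → K} (hs : IsTerm A B s) (ht : IsTerm A B t) :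
    letI := expansion K A B
    IsFormula A B fun x => Structure.RelMap R ![s x, t x] := by
  let _ := expansion K A B
  obtain ⟨σ, hσ⟩ := hs
  obtain ⟨τ, hτ⟩ := ht
  exact ⟨R.formula₂ σ τ, fun x => by rw [Formula.realize_rel₂, hσ, hτ]⟩

theorem IsFormula.le {s t : (ℕ → K) → K} (hs : IsTerm A B s) (ht : IsTerm A B t) :
    IsFormula A B fun x => s x ≤ t x :=
  IsFormula.rel₂ (Sum.inl (Sum.inl (Sum.inr orderRel.le))) hs ht

theorem IsFormula.mem_fst {t : (ℕ → K) → K} (ht : IsTerm A B t) :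
    IsFormula A B fun x => t x ∈ A :=
  IsFormula.rel₁ (Sum.inl (Sum.inr TwoPredRel.fst)) ht

theorem IsFormula.mem_snd {t : (ℕ → K) → K} (ht : IsTerm A B t) :
    IsFormula A B fun x => t x ∈ B :=
  IsFormula.rel₁ (Sum.inl (Sum.inr TwoPredRel.snd)) ht

theorem IsFormula.not {P : (ℕ → K) → Prop} (hP : IsFormula A B P) :
    IsFormula A B fun x => ¬ P x := by
  let _ := expansion K A B
  obtain ⟨φ, hφ⟩ := hP
  exact ⟨φ.not, fun x => by rw [Formula.realize_not, hφ]⟩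

theorem IsFormula.and {P Q : (ℕ → K) → Prop} (hP : IsFormula A B P) (hQ : IsFormula A B Q) :
    IsFormula A B fun x => P x ∧ Q x := by
  let _ := expansion K A B
  obtain ⟨φ, hφ⟩ := hP
  obtain ⟨ψ, hψ⟩ := hQ
  exact ⟨φ ⊓ ψ, fun x => by rw [Formula.realize_inf, hφ, hψ]⟩

theorem IsFormula.imp {P Q : (ℕ → K) → Prop} (hP : IsFormula A B P) (hQ : IsFormula A B Q) :
    IsFormula A B fun x => P x → Q x := by
  let _ := expansion K A B
  obtain ⟨φ, hφ⟩ := hP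
  obtain ⟨ψ, hψ⟩ := hQ
  exact ⟨φ.imp ψ, fun x => by rw [Formula.realize_imp, hφ, hψ]⟩

theorem IsFormula.or {P Q : (ℕ → K) → Prop} (hP : IsFormula A B P) (hQ : IsFormula A B Q) :
    IsFormula A B fun x => P x ∨ Q x := by
  simpa only [or_iff_not_imp_left] using hP.not.imp hQ

theorem IsFormula.lt {s t : (ℕ → K) → K} (hs : IsTerm A B s) (ht : IsTerm A B t) :
    IsFormula A B fun x => s x < t x := by
  simpa only [not_le] using (IsFormula.le ht hs).not

theorem IsFormula.comp {P : (ℕ → K) → Prop} (hP : IsFormula A B P) (g : ℕ → ℕ) :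
    IsFormula A B fun x => P (x ∘ g) := by
  let _ := expansion K A B
  obtain ⟨φ, hφ⟩ := hP
  exact ⟨φ.relabel g, fun x => by rw [Formula.realize_relabel, hφ]⟩

/-- Existential quantification over the `k`-th variable. -/
theorem IsFormula.exists (k : ℕ) {P : (ℕ → K) → K → Prop}
    (hP : IsFormula A B fun x => P x (x k))
    (hk : ∀ x y z, P (Function.update x k y) z ↔ P x z) :
    IsFormula A B fun x => ∃ y, P x y := by
  let _ := expansion K A B
  obtain ⟨φ, hφ⟩ := hP
  let g : ℕ → ℕ ⊕ Fin 1 := fun i => if i = k then .inr 0 else .inl i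
  refine ⟨(BoundedFormula.relabel (n := 1) (k := 0) g φ).ex, fun x => ?_⟩
  rw [Formula.Realize, BoundedFormula.realize_ex]
  refine exists_congr fun y => ?_
  rw [BoundedFormula.realize_relabel]
  have hg : (Sum.elim x ((Fin.snoc default y : Fin 1 → K) ∘ Fin.castAdd 0) ∘ g) =
      Function.update x k y := by
    funext i
    by_cases hi : i = k
    · subst hi
      simp [g, Fin.snoc]
    · simp [g, hi]
  have hφ' : φ.Realize (Function.update x k y) ↔ P (Function.update x k y) _ :=
    hφ (Function.update x k y)
  rw [hk, Function.update_self] at hφ'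
  rw [← hφ', Formula.Realize, ← hg]
  exact iff_of_eq (congrArg _ (Subsingleton.elim _ _))

/-- Universal quantification over the `k`-th variable. -/
theorem IsFormula.forall (k : ℕ) {P : (ℕ → K) → K → Prop}
    (hP : IsFormula A B fun x => P x (x k))
    (hk : ∀ x y z, P (Function.update x k y) z ↔ P x z) :
    IsFormula A B fun x => ∀ y, P x y := by
  have := (IsFormula.exists k (P := fun x y => ¬ P x y) hP.not
    fun x y z => not_congr (hk x y z)).not
  simpa only [not_exists, not_not] using this

theorem IsFormula.defines {P : K → Prop} (hP : IsFormula A B fun x => P (x 0)) :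
    Defines K A B {y | P y} := by
  let _ := expansion K A B
  obtain ⟨φ, hφ⟩ := hP
  -- Only variable 0 matters, so all variables can be collapsed to the single free one.
  refine ⟨φ.relabel fun _ => 0, ?_⟩
  ext x
  simp only [Set.mem_ofPred_eq, Formula.realize_relabel]
  exact (hφ (x ∘ fun _ => 0)).symm

end Definability

/-! ### Powers of `b` modulo powers of `a`, as an irrational rotation. -/

section Rotation

/-- The representative of `b ^ m` in `[1, a)` modulo powers of `a`. -/
noncomputable def residue (a b : ℝ) (m : ℕ) : ℝ := b ^ m / a ^ ⌊m * Real.logb a b⌋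

variable {a b : ℝ}

theorem residue_eq_rpow (ha : 1 < a) (hb : 1 < b) (m : ℕ) :
    residue a b m = a ^ Int.fract (m * Real.logb a b) := by
  have ha0 : 0 < a := by linarith
  rw [residue, ← Int.self_sub_floor, Real.rpow_sub ha0, Real.rpow_intCast, mul_comm (m : ℝ),
    Real.rpow_mul ha0.le, Real.rpow_logb ha0 ha.ne' (by linarith), Real.rpow_natCast]

theorem one_le_residue (ha : 1 < a) (hb : 1 < b) (m : ℕ) : 1 ≤ residue a b m := by
  rw [residue_eq_rpow ha hb]
  exact Real.one_le_rpow ha.le (Int.fract_nonneg _)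

theorem residue_lt (ha : 1 < a) (hb : 1 < b) (m : ℕ) : residue a b m < a := by
  rw [residue_eq_rpow ha hb]
  simpa using Real.rpow_lt_rpow_of_exponent_lt ha (Int.fract_lt_one (m * Real.logb a b))

theorem one_lt_residue (ha : 1 < a) (hb : 1 < b) (h : Irrational (Real.logb a b)) {m : ℕ}
    (hm : m ≠ 0) : 1 < residue a b m := by
  rw [residue_eq_rpow ha hb]
  refine Real.one_lt_rpow ha ((Int.fract_nonneg _).lt_of_ne' fun h0 => ?_)
  obtain ⟨z, hz⟩ := Int.fract_eq_zero_iff.1 h0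
  exact (h.natCast_mul hm).ne_int z hz.symm

/-- Fractional parts of the exponents add, either without or with a carry. -/
theorem residue_add (ha : 1 < a) (hb : 1 < b) (m j : ℕ) :
    residue a b (m + j) = residue a b m * residue a b j ∨
      residue a b (m + j) = residue a b m * residue a b j / a := by
  have ha0 : 0 < a := by linarith
  simp only [residue_eq_rpow ha hb, Nat.cast_add, add_mul]
  rw [← Real.rpow_add ha0, ← Real.rpow_sub_one ha0.ne']
  set s := m * Real.logb a b
  set t := j * Real.logb a b
  rcases lt_or_ge (Int.fract s + Int.fract t) 1 with h | h
  · refine .inl (congrArg _ (Int.fract_eq_iff.2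
      ⟨by linarith [Int.fract_nonneg s, Int.fract_nonneg t], h, ⌊s⌋ + ⌊t⌋, ?_⟩))
    simp only [Int.fract]; push_cast; ring
  · refine .inr (congrArg _ (Int.fract_eq_iff.2
      ⟨by linarith, by linarith [Int.fract_lt_one s, Int.fract_lt_one t], ⌊s⌋ + ⌊t⌋ + 1, ?_⟩))
    simp only [Int.fract]; push_cast; ring

/-- Residues of powers whose exponents differ by at most `N` are uniformly separated. -/
theorem exists_le_abs_residue_sub (ha : 1 < a) (hb : 1 < b) (h : Irrational (Real.logb a b))
    (N : ℕ) : ∃ κ > 0, ∀ m j, j ≠ 0 → j ≤ N → κ ≤ |residue a b (m + j) - residue a b m| := by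
  have ha0 : 0 < a := by linarith
  induction N with
  | zero => exact ⟨1, one_pos, fun m j h0 hj => (h0 (Nat.le_zero.1 hj)).elim⟩
  | succ N ih =>
    obtain ⟨κ, hκ, ih⟩ := ih
    have h1 : 0 < residue a b (N + 1) - 1 := sub_pos.2 (one_lt_residue ha hb h N.succ_ne_zero)
    have h2 : 0 < 1 - residue a b (N + 1) / a :=
      sub_pos.2 ((div_lt_one ha0).2 (residue_lt ha hb _))
    refine ⟨min κ (min (residue a b (N + 1) - 1) (1 - residue a b (N + 1) / a)), by positivity,
      fun m j h0 hj => ?_⟩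
    rcases Nat.le_succ_iff.1 hj with hj | rfl
    · exact (min_le_left _ _).trans (ih m j h0 hj)
    refine (min_le_right _ _).trans ?_
    have hm := one_le_residue ha hb m
    -- The difference is `residue a b m ≥ 1` times a nonzero factor that depends only on `N + 1` and
    -- on the carry.
    rcases residue_add ha hb m (N + 1) with e | e <;> rw [Nat.succ_eq_add_one, e]
    · refine (min_le_left _ _).trans (le_trans ?_ (le_abs_self _))
      nlinarith
    · refine (min_le_right _ _).trans (le_trans ?_ (neg_le_abs _))
      rw [mul_div_assoc]
      nlinarith

/-- Residues of arbitrarily large powers meet every subinterval of `[1, a)`. -/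
theorem exists_residue_mem_Ioo (ha : 1 < a) (hb : 1 < b) (h : Irrational (Real.logb a b))
    {p q : ℝ} (hp : 1 ≤ p) (hpq : p < q) (hq : q ≤ a) (N : ℕ) :
    ∃ m ≥ N, p < residue a b m ∧ residue a b m < q := by
  have ha0 : 0 < a := by linarith
  have hd : DenseRange (· • (Real.logb a b : AddCircle (1 : ℝ)) : ℤ → AddCircle (1 : ℝ)) :=
    AddCircle.denseRange_zsmul_coe_iff.2 (by simpa using h)
  set s := Real.logb a p
  set t := Real.logb a q
  have hs : 0 ≤ s := Real.logb_nonneg ha hp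
  have hst : s < t := Real.logb_lt_logb ha (by linarith) hpq
  have ht : t ≤ 1 := by
    rw [← Real.logb_self_eq_one ha]
    exact Real.logb_le_logb_of_le ha (by linarith) hq
  -- Density of the ℤ-orbit makes every point a cluster point of the forward orbit, which yields
  -- arbitrarily large natural exponents.
  have hcl : MapClusterPt (((s + t) / 2 : ℝ) : AddCircle (1 : ℝ)) Filter.atTop
      (· • (Real.logb a b : AddCircle (1 : ℝ)) : ℕ → AddCircle (1 : ℝ)) :=
    ((mapClusterPt_atTop_nsmul_tfae _ _).out 0 3).2 (hd _)
  have hU : ((↑) : ℝ → AddCircle (1 : ℝ)) '' Set.Ioo s t ∈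
      nhds (((s + t) / 2 : ℝ) : AddCircle (1 : ℝ)) :=
    (QuotientAddGroup.isOpenMap_coe _ isOpen_Ioo).mem_nhds ⟨_, ⟨by linarith, by linarith⟩, rfl⟩
  obtain ⟨m, hm, y, hy, e⟩ := Filter.frequently_atTop.1 (hcl.frequently hU) N
  refine ⟨m, hm, ?_⟩
  have hf : Int.fract (m * Real.logb a b) = y := by
    have e' : (y : AddCircle (1 : ℝ)) = ((m * Real.logb a b : ℝ) : AddCircle (1 : ℝ)) := by
      rw [e, ← nsmul_eq_mul]; rfl
    obtain ⟨z, hz⟩ := AddCircle.coe_eq_zero_iff (1 : ℝ) |>.1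
      (show ((m * Real.logb a b - y : ℝ) : AddCircle (1 : ℝ)) = 0 by
        rw [AddCircle.coe_sub, e', sub_self])
    rw [Int.fract_eq_iff]
    refine ⟨by linarith [hy.1], by linarith [hy.2], z, by simpa using hz.symm⟩
  rw [residue_eq_rpow ha hb, hf]
  exact ⟨(Real.logb_lt_iff_lt_rpow ha (by linarith)).1 hy.1,
    (Real.lt_logb_iff_rpow_lt ha (by linarith)).1 hy.2⟩

end Rotation

/-! ### Coding finite sequences by a point in nested intervals. -/

section Coding

/-- Given intervals `(R k - h k, R k)` with tail sums `τ` of their lengths, if some `R m` lies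
inside `(p, q)` with enough room on both sides, then one of the intervals with index at least `N`
is contained in `(p, q)` and disjoint from all its predecessors with index at least `N`. -/
theorem exists_Ioo_disjoint_of_lt {R h τ : ℕ → ℝ} (hh : ∀ k, 0 ≤ h k)
    (hτ : ∀ k, τ k = τ (k + 1) + h k) {N : ℕ} {p q : ℝ} (m : ℕ) (hm : N ≤ m)
    (hp : p < R m - (τ N - τ (m + 1))) (hq : R m + (τ N - τ m) < q) :
    ∃ m ≥ N, p < R m - h m ∧ R m < q ∧
      ∀ k, N ≤ k → k < m → R m ≤ R k - h k ∨ R k ≤ R m - h m := by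
  have hanti : Antitone τ := antitone_nat_of_succ_le fun k => by linarith [hτ k, hh k]
  induction m using Nat.strong_induction_on with
  | _ m ih =>
    by_cases hd : ∀ k, N ≤ k → k < m → R m ≤ R k - h k ∨ R k ≤ R m - h m
    · exact ⟨m, hm, by linarith [hτ m, hanti hm], by linarith [hanti hm], hd⟩
    · push Not at hd
      obtain ⟨k, hNk, hkm, h1, h2⟩ := hd
      -- Passing to an earlier interval that meets the current one moves `R` left by less than `h m`
      -- and right by less than `h k`; the margins, being partial sums of lengths, absorb this.
      refine ih k hkm hNk ?_ ?_
      · linarith [hτ m, hanti (Nat.succ_le_of_lt hkm)]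
      · linarith [hτ k, hanti (Nat.succ_le_of_lt hkm)]

/-- The number `c` attaches the value `v > 1` to the exponent `m` at scale `δ`: the distance by
which `c` lies to the left of the residue of `b ^ m` is `1 / v` times `δ / b ^ m`. -/
def HasValue (a b δ c : ℝ) (m : ℕ) (v : ℝ) : Prop :=
  1 < v ∧ v * (residue a b m - c) = δ / b ^ m

variable {a b δ c : ℝ}

theorem HasValue.mem_Ioo (hb : 1 < b) (hδ : 0 < δ) {m : ℕ} {v : ℝ} (hv : HasValue a b δ c m v) :
    c ∈ Set.Ioo (residue a b m - δ / b ^ m) (residue a b m) := by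
  have hpos : 0 < δ / b ^ m := by positivity
  have h0 : 0 < residue a b m - c := by
    by_contra hneg
    nlinarith [hv.1, hv.2]
  exact ⟨by nlinarith [hv.1, hv.2], by linarith⟩

theorem HasValue.unique (hb : 1 < b) (hδ : 0 < δ) {m : ℕ} {v w : ℝ} (hv : HasValue a b δ c m v)
    (hw : HasValue a b δ c m w) : v = w :=
  mul_right_cancel₀ (sub_pos.2 (hv.mem_Ioo hb hδ).2).ne' (hv.2.trans hw.2.symm)

theorem exists_hasValue (hb : 1 < b) (hδ : 0 < δ) {m : ℕ} {t ρ : ℝ} (ht : 1 ≤ t) (hρ : 0 < ρ)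
    (hc : c ∈ Set.Ioo (residue a b m - δ / b ^ m / t) (residue a b m - δ / b ^ m / (t + ρ))) :
    ∃ v, HasValue a b δ c m v ∧ t < v ∧ v < t + ρ := by
  have hpos : 0 < δ / b ^ m := by positivity
  obtain ⟨h1, h2⟩ := hc
  set d := δ / b ^ m
  have h0 : 0 < residue a b m - c := by
    have : 0 < d / (t + ρ) := by positivity
    linarith
  have ht' : t < d / (residue a b m - c) := by
    rw [lt_div_iff₀ h0, mul_comm, ← lt_div_iff₀ (by linarith)]
    linarith
  refine ⟨d / (residue a b m - c), ⟨by linarith, div_mul_cancel₀ _ h0.ne'⟩, ht', ?_⟩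
  rw [div_lt_iff₀ h0, mul_comm, ← div_lt_iff₀ (by linarith)]
  linarith

/-- Starting from the exponent `1`, the consecutive values attached by `c` to exponents up to `M`
are `ρ`-close to `2, 3, …, i + 2`. -/
structure CodesUpTo (a b δ ρ : ℝ) (i M : ℕ) (c : ℝ) : Prop where
  first : ∃ v, HasValue a b δ c 1 v ∧ 2 < v ∧ v < 2 + ρ
  last : ∃ v, HasValue a b δ c M v ∧ (i : ℝ) + 2 < v ∧ v < i + 2 + ρ
  step : ∀ s s' v v', 1 ≤ s → s < s' → s' ≤ M → HasValue a b δ c s v → HasValue a b δ c s' v' →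
    (∀ r w, s < r → r < s' → ¬ HasValue a b δ c r w) →
    ∃ k < i, (k : ℝ) + 2 < v ∧ v < k + 2 + ρ ∧ (k : ℝ) + 3 < v' ∧ v' < k + 3 + ρ

/-- As no exponent strictly between `M` and `m` has a value, the only new consecutive pair is `(M,
m)`. -/
theorem CodesUpTo.succ {ρ : ℝ} {i M m : ℕ} (hb : 1 < b) (hδ : 0 < δ)
    (h : CodesUpTo a b δ ρ i M c) (hMm : M < m)
    (hm : ∃ v, HasValue a b δ c m v ∧ (i : ℝ) + 3 < v ∧ v < i + 3 + ρ)
    (hno : ∀ r w, M < r → r < m → ¬ HasValue a b δ c r w) :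
    CodesUpTo a b δ ρ (i + 1) m c := by
  refine ⟨h.first, ?_, fun s s' v v' hs hss' hs' hv hv' hbetween => ?_⟩
  · obtain ⟨v, hv, h1, h2⟩ := hm
    exact ⟨v, hv, by push_cast; linarith, by push_cast; linarith⟩
  obtain ⟨u, hu, hu1, hu2⟩ := h.last
  rcases le_or_gt s' M with hsM | hsM
  · obtain ⟨k, hk, hk'⟩ := h.step s s' v v' hs hss' hsM hv hv' hbetween
    exact ⟨k, by omega, hk'⟩
  obtain rfl : s' = m := by
    by_contra hne
    exact hno s' v' hsM (by omega) hv'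
  obtain rfl : s = M := by
    rcases lt_trichotomy s M with hlt | heq | hgt
    · exact (hbetween M u hlt hsM hu).elim
    · exact heq
    · exact (hno s v hgt hss' hv).elim
  obtain ⟨w, hw, hw1, hw2⟩ := hm
  obtain rfl := hv.unique hb hδ hu
  obtain rfl := hv'.unique hb hδ hw
  exact ⟨i, by omega, hu1, hu2, hw1, hw2⟩

/-- The exact length is `ρ / (t * (t + ρ)) * d`. A bound uniform in `t` lets the construction fix
its constants before the induction. -/
theorem le_sub_Ioo {t ρ d : ℝ} {n : ℕ} (ht : 2 ≤ t) (htn : t ≤ n + 2) (hρ : 0 < ρ) (hρ1 : ρ ≤ 1)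
    (hd : 0 < d) (x : ℝ) :
    ρ / (n + 3) ^ 2 * d ≤ (x - d / (t + ρ)) - (x - d / t) := by
  have e : (x - d / (t + ρ)) - (x - d / t) = ρ / (t * (t + ρ)) * d := by
    field_simp; ring
  rw [e]
  gcongr
  nlinarith

/-- Some rational number codes an approximation of the sequence `2, 3, …, n + 2`. -/
theorem exists_codesUpTo (ha : 1 < a) (hb : 1 < b) (h : Irrational (Real.logb a b)) (n : ℕ)
    {ρ : ℝ} (hρ : 0 < ρ) (hρ1 : ρ ≤ 1) :
    ∃ δ : ℚ, 0 < δ ∧ ∃ c : ℚ, ∃ M ≥ 1, CodesUpTo a b δ ρ n M c := by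
  set ℓ := ρ / ((n : ℝ) + 3) ^ 2 with hℓ
  have hℓ0 : 0 < ℓ := by positivity
  -- The constants are chosen in the order `ℓ`, `N`, `κ`, `δ`. This is not circular: `N` compares
  -- tails of `D` with `D M`, a ratio independent of `δ` and `M`.
  obtain ⟨N, hN⟩ := pow_unbounded_of_one_lt (2 / ((b - 1) * ℓ)) hb
  obtain ⟨κ, hκ, hsep⟩ := exists_le_abs_residue_sub ha hb h N
  have hR1 := one_lt_residue ha hb h one_ne_zero
  obtain ⟨δ, hδ0, hδ⟩ := exists_rat_btwn (lt_min hκ (sub_pos.2 hR1))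
  refine ⟨δ, by exact_mod_cast hδ0, ?_⟩
  have hδκ := hδ.trans_le (min_le_left _ _)
  have hδR := hδ.trans_le (min_le_right _ _)
  have hb1 : 0 < b - 1 := by linarith
  have hb0 : 0 < b := by linarith
  set D : ℕ → ℝ := fun m => δ / b ^ m with hD
  have hD0 : ∀ m, 0 < D m := fun m => by positivity
  have hDle : ∀ m, D m ≤ δ := fun m => div_le_self hδ0.le (one_le_pow₀ hb.le)
  -- The geometric tail sum of the lengths `D`.
  set τ : ℕ → ℝ := fun m => D m * (b / (b - 1)) with hτdef
  have hτ : ∀ k, τ k = τ (k + 1) + D k := fun k => by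
    simp only [hτdef, hD, pow_succ]; field_simp; ring
  have hτ0 : ∀ k, 0 < τ k := fun k => by have := hD0 k; positivity
  suffices H : ∀ i ≤ n, ∃ M p q, 1 ≤ M ∧ 1 ≤ p ∧ p < q ∧ residue a b M - D M ≤ p ∧
      q ≤ residue a b M ∧ ℓ * D M ≤ q - p ∧
      ∀ c ∈ Set.Ioo p q, CodesUpTo a b δ ρ i M c by
    obtain ⟨M, p, q, hM, -, hpq, -, -, -, hc⟩ := H n le_rfl
    obtain ⟨c, hpc, hcq⟩ := exists_rat_btwn hpq
    exact ⟨c, M, hM, hc c ⟨hpc, hcq⟩⟩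
  intro i
  induction i with
  | zero =>
    intro _
    have hlen := le_sub_Ioo (t := 2) (n := n) le_rfl (by linarith [n.cast_nonneg (α := ℝ)])
      hρ hρ1 (hD0 1) (residue a b 1)
    have h2 : D 1 / 2 ≤ D 1 := half_le_self (hD0 1).le
    have h3 : 0 < D 1 / (2 + ρ) := by have := hD0 1; positivity
    refine ⟨1, residue a b 1 - D 1 / 2, residue a b 1 - D 1 / (2 + ρ), le_rfl,
      by linarith [hDle 1], ?_, by linarith, by linarith, hlen, fun c hc => ?_⟩
    · have := mul_pos hℓ0 (hD0 1)
      linarith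
    · have hv := exists_hasValue hb hδ0 one_le_two hρ hc
      exact ⟨hv, by simpa using hv, fun s s' v v' hs hss' hs' => by omega⟩
  | succ i ih =>
    intro hi
    obtain ⟨M, p, q, hM, hp1, hpq, hMp, hqM, hlen, hc⟩ := ih (by omega)
    have h2τ : 2 * τ (M + N + 1) < ℓ * D M := by
      have e : 2 * τ (M + N + 1) = D M * (2 / ((b - 1) * b ^ N)) := by
        simp only [hτdef, hD, pow_succ, pow_add]; field_simp
      rw [e, mul_comm ℓ]
      refine mul_lt_mul_of_pos_left ?_ (hD0 M)
      rw [div_lt_iff₀ (by positivity)] at hN ⊢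
      linarith
    -- A residue at distance more than the whole tail from both ends leaves the room required for
    -- the disjointness lemma.
    obtain ⟨m₀, hm₀, hpm₀, hqm₀⟩ := exists_residue_mem_Ioo ha hb h
      (p := p + τ (M + N + 1)) (q := q - τ (M + N + 1)) (by linarith [hτ0 (M + N + 1)])
      (by linarith) (by linarith [hτ0 (M + N + 1), residue_lt ha hb M]) (M + N + 1)
    obtain ⟨m, hm, hpm, hqm, hdisj⟩ := exists_Ioo_disjoint_of_lt (R := residue a b) (h := D)
      (τ := τ) (fun k => (hD0 k).le) hτ (p := p) (q := q) m₀ hm₀ (by linarith [hτ0 (m₀ + 1)])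
      (by linarith [hτ0 m₀])
    have hi' : (i : ℝ) + 3 ≤ n + 2 := by exact_mod_cast (by omega : i + 3 ≤ n + 2)
    have hi0 : (0 : ℝ) ≤ i := i.cast_nonneg
    have hlen' := le_sub_Ioo (t := i + 3) (n := n) (by linarith) hi' hρ hρ1 (hD0 m)
      (residue a b m)
    have h2 : D m / (i + 3) ≤ D m := div_le_self (hD0 m).le (by linarith)
    have h3 : 0 < D m / (i + 3 + ρ) := by have := hD0 m; positivity
    refine ⟨m, residue a b m - D m / (i + 3), residue a b m - D m / (i + 3 + ρ), by omega,
      by linarith, ?_, by linarith, by linarith, hlen', fun c hc' => ?_⟩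
    · have := mul_pos hℓ0 (hD0 m)
      linarith
    refine (hc c ⟨by linarith [hc'.1], by linarith [hc'.2]⟩).succ hb hδ0 (by omega)
      (exists_hasValue hb hδ0 (by linarith) hρ hc') fun r w hMr hrm hw => ?_
    obtain ⟨hr1, hr2⟩ := hw.mem_Ioo hb hδ0
    change residue a b r - D r < c at hr1
    obtain ⟨hc1, hc2⟩ := hc'
    -- For `r ≤ M + N`, `c` would lie in the intervals of both `r` and `M`, of length at most `δ <
    -- κ`, against separation. For larger `r`, the interval of `r` is disjoint from that of `m`.
    rcases le_or_gt r (M + N) with hrN | hrN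
    · have hs := hsep M (r - M) (by omega) (by omega)
      rw [Nat.add_sub_cancel' hMr.le] at hs
      have := hDle r
      have := hDle M
      have : |residue a b r - residue a b M| < κ := by
        rw [abs_lt]; constructor <;> linarith
      linarith
    · rcases hdisj r hrN hrm with hd | hd <;> linarith

end Coding

/-! ### The defining formula. -/

section Defining

variable {K : Subfield ℝ}

/-- The first-order counterpart of `HasValue`, for an arbitrary element `b`. -/
def Attaches (A : Set K) (α δ c b v : K) : Prop :=
  ∃ a, a ∈ A ∧ a ≤ b ∧ b < α * a ∧ 1 < v ∧ v * (b * (b - c * a)) = δ * a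

/-- The values attached by `c` at scale `δ` to the elements of `β ^ ℤ` between `β` and `u` start at
`2` and end at `x + 2`, up to `ε`, and grow by `1` up to errors controlled by `ε`. -/
def CountsTo (A B : Set K) (α β x ε δ c u : K) : Prop :=
  u ∈ B ∧ β ≤ u ∧
  (∃ v, Attaches A α δ c β v ∧ 2 - ε ≤ v ∧ v ≤ 2 + ε) ∧
  (∃ v, Attaches A α δ c u v ∧ x + 2 - ε ≤ v ∧ v ≤ x + 2 + ε) ∧
  ∀ s s' v v', s ∈ B → s' ∈ B → β ≤ s → s < s' → s' ≤ u →
    Attaches A α δ c s v → Attaches A α δ c s' v' →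
    (∀ r w, r ∈ B → s < r → r < s' → ¬ Attaches A α δ c r w) →
    (v' - v - 1) * (v * v') ≤ ε * (v' - v) ∧ (1 + v - v') * (v * v') ≤ ε * (v' - v)

/-- The formula defining the natural numbers. -/
def IsCount (A B : Set K) (α β x : K) : Prop :=
  ∀ ε, 0 < ε → ∃ δ, 0 < δ ∧ ∃ c u, CountsTo A B α β x ε δ c u

theorem isFormula_attaches {A B : Set K} (α : K) {δ c b v : (ℕ → K) → K} (hδ : IsTerm A B δ)
    (hc : IsTerm A B c) (hb : IsTerm A B b) (hv : IsTerm A B v) (k : ℕ)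
    (hk : ∀ x y, δ (Function.update x k y) = δ x ∧ c (Function.update x k y) = c x ∧
      b (Function.update x k y) = b x ∧ v (Function.update x k y) = v x) :
    IsFormula A B fun x => Attaches A α (δ x) (c x) (b x) (v x) := by
  refine IsFormula.exists k ?_ fun x y z => by simp only [hk]
  have ha : IsTerm A B fun x => x k := .var k
  exact (IsFormula.mem_fst ha).and ((IsFormula.le ha hb).and ((IsFormula.lt hb
    ((IsTerm.const α).mul ha)).and ((IsFormula.lt (.const 1) hv).and
    (IsFormula.eq (hv.mul (hb.mul (hb.sub (hc.mul ha)))) (hδ.mul ha)))))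

theorem isFormula_isCount (A B : Set K) (α β : K) :
    IsFormula A B fun x => IsCount A B α β (x 0) := by
  have V : ∀ i, IsTerm A B fun x => x i := .var
  have hβ : IsTerm A B fun _ => β := .const β
  have h1 : IsTerm A B fun _ => 1 := .const 1
  have h2 : IsTerm A B fun _ => 2 := .const 2
  unfold IsCount CountsTo
  -- Every quantifier in scope gets a fresh variable number, so independence of the bound variable
  -- holds definitionally.
  refine IsFormula.forall 1 ?_ fun _ _ _ => Iff.rfl
  refine (IsFormula.lt (.const 0) (V 1)).imp ?_
  refine IsFormula.exists 2 ?_ fun _ _ _ => Iff.rfl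
  refine (IsFormula.lt (.const 0) (V 2)).and ?_
  refine IsFormula.exists 3 ?_ fun _ _ _ => Iff.rfl
  refine IsFormula.exists 4 ?_ fun _ _ _ => Iff.rfl
  refine (IsFormula.mem_snd (V 4)).and ((IsFormula.le hβ (V 4)).and (.and ?_ (.and ?_ ?_)))
  · refine IsFormula.exists 5 ?_ fun _ _ _ => Iff.rfl
    exact (isFormula_attaches α (V 2) (V 3) hβ (V 5) 6 fun _ _ => ⟨rfl, rfl, rfl, rfl⟩).and
      ((IsFormula.le (h2.sub (V 1)) (V 5)).and (IsFormula.le (V 5) (h2.add (V 1))))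
  · refine IsFormula.exists 5 ?_ fun _ _ _ => Iff.rfl
    exact (isFormula_attaches α (V 2) (V 3) (V 4) (V 5) 6 fun _ _ => ⟨rfl, rfl, rfl, rfl⟩).and
      ((IsFormula.le (((V 0).add h2).sub (V 1)) (V 5)).and
        (IsFormula.le (V 5) (((V 0).add h2).add (V 1))))
  · refine IsFormula.forall 5 ?_ fun _ _ _ => Iff.rfl
    refine IsFormula.forall 6 ?_ fun _ _ _ => Iff.rfl
    refine IsFormula.forall 7 ?_ fun _ _ _ => Iff.rfl
    refine IsFormula.forall 8 ?_ fun _ _ _ => Iff.rfl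
    refine (IsFormula.mem_snd (V 5)).imp ((IsFormula.mem_snd (V 6)).imp
      ((IsFormula.le hβ (V 5)).imp ((IsFormula.lt (V 5) (V 6)).imp
      ((IsFormula.le (V 6) (V 4)).imp
      ((isFormula_attaches α (V 2) (V 3) (V 5) (V 7) 9 fun _ _ => ⟨rfl, rfl, rfl, rfl⟩).imp
      ((isFormula_attaches α (V 2) (V 3) (V 6) (V 8) 9 fun _ _ => ⟨rfl, rfl, rfl, rfl⟩).imp (.imp ?_
      ((IsFormula.le ((((V 8).sub (V 7)).sub h1).mul ((V 7).mul (V 8)))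
        ((V 1).mul ((V 8).sub (V 7)))).and
      (IsFormula.le (((h1.add (V 7)).sub (V 8)).mul ((V 7).mul (V 8)))
        ((V 1).mul ((V 8).sub (V 7))))))))))))
    refine IsFormula.forall 9 ?_ fun _ _ _ => Iff.rfl
    refine IsFormula.forall 10 ?_ fun _ _ _ => Iff.rfl
    exact (IsFormula.mem_snd (V 9)).imp ((IsFormula.lt (V 5) (V 9)).imp
      ((IsFormula.lt (V 9) (V 6)).imp
      (isFormula_attaches α (V 2) (V 3) (V 9) (V 10) 11 fun _ _ => ⟨rfl, rfl, rfl, rfl⟩).not))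

/-! ### Correctness of the formula. -/

variable {α β : K}

theorem coe_zpow_subfield (x : K) (k : ℤ) : ((x ^ k : K) : ℝ) = (x : ℝ) ^ k :=
  map_zpow₀ K.subtype x k

/-- The half-open range `(β ^ m / α, β ^ m]` contains exactly one power of `α`, the one in
`residue`; clearing denominators gives the polynomial equation. -/
theorem attaches_pow_iff (hα : 1 < (α : ℝ)) (hβ : 1 < (β : ℝ)) (δ c v : K) (m : ℕ) :
    Attaches (integerPowers α) α δ c (β ^ m) v ↔ HasValue (α : ℝ) β δ c m v := by
  have hα0 : (0 : ℝ) < α := by linarith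
  have hβ0 : (0 : ℝ) < β := by linarith
  have key : ∀ a : ℝ, 0 < a → ((v : ℝ) * (β ^ m / a - c) = δ / β ^ m ↔
      (v : ℝ) * (β ^ m * (β ^ m - c * a)) = δ * a) := fun a ha => by
    rw [eq_div_iff (by positivity), ← mul_left_inj' ha.ne']
    have : (v : ℝ) * (β ^ m / a - c) * β ^ m * a = v * (β ^ m * (β ^ m - c * a)) := by
      field_simp
    rw [this]
  have hR1 := one_le_residue hα hβ m
  have hR2 := residue_lt hα hβ m
  unfold HasValue
  rw [residue] at *
  set k := ⌊m * Real.logb (α : ℝ) β⌋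
  have hak : (0 : ℝ) < (α : ℝ) ^ k := by positivity
  rw [one_le_div hak] at hR1
  rw [div_lt_iff₀ hak] at hR2
  rw [key _ hak]
  constructor
  · rintro ⟨a, ⟨l, rfl⟩, h1, h2, h3, h4⟩
    have h1' : (α : ℝ) ^ l ≤ β ^ m := by exact_mod_cast h1
    have h2' : (β : ℝ) ^ m < α * α ^ l := by exact_mod_cast h2
    have e1 : l < k + 1 := by
      rw [← zpow_lt_zpow_iff_right₀ hα, zpow_add_one₀ hα0.ne', mul_comm]
      linarith
    have e2 : k < l + 1 := by
      rw [← zpow_lt_zpow_iff_right₀ hα, zpow_add_one₀ hα0.ne' l, mul_comm]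
      linarith
    obtain rfl : l = k := by omega
    exact ⟨by exact_mod_cast h3, by simpa [coe_zpow_subfield] using congrArg ((↑) : K → ℝ) h4⟩
  · rintro ⟨h3, h4⟩
    exact ⟨α ^ k, ⟨k, rfl⟩, by exact_mod_cast hR1, by exact_mod_cast hR2, by exact_mod_cast h3,
      Subtype.coe_injective (by simpa [coe_zpow_subfield] using h4)⟩

theorem exists_nat_pow_of_le (hβ : 1 < (β : ℝ)) {s : K} (hs : s ∈ integerPowers β) (h : β ≤ s) :
    ∃ m : ℕ, 1 ≤ m ∧ s = β ^ m := by
  obtain ⟨k, rfl⟩ := hs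
  have hβ' : 1 < β := by exact_mod_cast hβ
  have hk : 1 ≤ k := by
    rw [← zpow_le_zpow_iff_right₀ hβ', zpow_one]
    exact h
  lift k to ℕ using by omega
  exact ⟨k, by omega, by simp⟩

/-- Divided by `v * v'`, the step condition reads `|v' - v - 1| ≤ ε * (1 / v - 1 / v')`. These
errors telescope to at most `ε`; the two endpoint conditions cost another `ε` each. -/
theorem CountsTo.exists_nat (hα : 1 < (α : ℝ)) (hβ : 1 < (β : ℝ)) {x ε δ c u : K}
    (hε : 0 < ε) (hδ : 0 < δ)
    (h : CountsTo (integerPowers α) (integerPowers β) α β x ε δ c u) :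
    ∃ n : ℕ, |(x : ℝ) - n| ≤ 3 * ε := by
  obtain ⟨hu, hβu, ⟨v₀, hv₀, hv₀l, hv₀u⟩, ⟨v₁, hv₁, hv₁l, hv₁u⟩, hstep⟩ := h
  obtain ⟨M, hM, rfl⟩ := exists_nat_pow_of_le hβ hu hβu
  have hβ' : 1 < β := by exact_mod_cast hβ
  have hβ1 : β = β ^ 1 := (pow_one β).symm
  have hδ' : (0 : ℝ) < δ := by exact_mod_cast hδ
  have hε' : (0 : ℝ) < ε := by exact_mod_cast hε
  rw [hβ1, attaches_pow_iff hα hβ] at hv₀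
  rw [attaches_pow_iff hα hβ] at hv₁
  have main : ∀ m, 1 ≤ m → m ≤ M → ∀ v : K, HasValue (α : ℝ) β δ c m v →
      ∃ n : ℕ, |(v : ℝ) - v₀ - n| ≤ ε * (1 / v₀ - 1 / v) := by
    intro m
    induction m using Nat.strong_induction_on with
    | _ m ih =>
      intro hm hmM v hv
      rcases hm.eq_or_lt with rfl | hm1
      · exact ⟨0, by rw [hv.unique hβ hδ' hv₀]; simp⟩
      let Q : ℕ → Prop := fun k => 1 ≤ k ∧ ∃ w : K, HasValue (α : ℝ) β δ c k w
      classical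
      -- The preceding exponent with a value; it exists because the exponent `1` has one.
      let j := Nat.findGreatest Q (m - 1)
      obtain ⟨hj1, w, hw⟩ : Q j :=
        Nat.findGreatest_spec (P := Q) (m := 1) (by omega) ⟨le_rfl, v₀, hv₀⟩
      have hjm : j < m := by
        have := Nat.findGreatest_le (P := Q) (m - 1)
        omega
      obtain ⟨n, hn⟩ := ih j hjm hj1 (by omega) w hw
      have hs := hstep (β ^ j) (β ^ m) w v ⟨j, by simp⟩ ⟨m, by simp⟩
        (by simpa using pow_le_pow_right₀ hβ'.le hj1) (pow_lt_pow_right₀ hβ' hjm)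
        (pow_le_pow_right₀ hβ'.le hmM) ((attaches_pow_iff hα hβ _ _ _ _).2 hw)
        ((attaches_pow_iff hα hβ _ _ _ _).2 hv) fun r z hr hjr hrm hz => by
          obtain ⟨k, hk, rfl⟩ := exists_nat_pow_of_le hβ hr
            ((by simpa using pow_le_pow_right₀ hβ'.le hj1 : β ≤ β ^ j).trans hjr.le)
          rw [attaches_pow_iff hα hβ] at hz
          rw [pow_lt_pow_iff_right₀ hβ'] at hjr hrm
          exact Nat.findGreatest_is_greatest (P := Q) hjr (by omega) ⟨hk, z, hz⟩
      have hs1 : ((v : ℝ) - w - 1) * (w * v) ≤ ε * (v - w) := by exact_mod_cast hs.1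
      have hs2 : ((1 : ℝ) + w - v) * (w * v) ≤ ε * (v - w) := by exact_mod_cast hs.2
      have hw0 : (0 : ℝ) < w := by linarith [hw.1]
      have hv0 : (0 : ℝ) < v := by linarith [hv.1]
      have e : (ε : ℝ) * (1 / w - 1 / v) = ε * (v - w) / (w * v) := by field_simp
      rw [← le_div_iff₀ (by positivity), ← e] at hs1 hs2
      refine ⟨n + 1, ?_⟩
      rw [abs_le] at hn ⊢
      push_cast
      constructor <;> linarith
  obtain ⟨n, hn⟩ := main M hM le_rfl v₁ hv₁
  have hv₀' : (1 : ℝ) / v₀ ≤ 1 := by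
    rw [div_le_one (by linarith [hv₀.1])]
    exact hv₀.1.le
  have hv₁' : (0 : ℝ) < 1 / v₁ := one_div_pos.2 (by linarith [hv₁.1])
  have hle : (ε : ℝ) * (1 / v₀ - 1 / v₁) ≤ ε * 1 := by
    refine mul_le_mul_of_nonneg_left ?_ hε'.le
    linarith
  have a1 : (2 : ℝ) - ε ≤ v₀ := by exact_mod_cast hv₀l
  have a2 : (v₀ : ℝ) ≤ 2 + ε := by exact_mod_cast hv₀u
  have a3 : (x : ℝ) + 2 - ε ≤ v₁ := by exact_mod_cast hv₁l
  have a4 : (v₁ : ℝ) ≤ x + 2 + ε := by exact_mod_cast hv₁u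
  refine ⟨n, ?_⟩
  rw [abs_le] at hn ⊢
  constructor <;> linarith

/-- The value solves a linear equation over `K`, so quantifying over values in `K` loses none of the
real ones. -/
theorem HasValue.exists_coe {δ c : K} {m : ℕ} {v : ℝ} (hβ : 1 < (β : ℝ)) (hδ : (0 : ℝ) < δ)
    (hv : HasValue (α : ℝ) β δ c m v) : ∃ w : K, (w : ℝ) = v := by
  have h := sub_pos.2 (hv.mem_Ioo hβ hδ).2
  have h' := hv.2
  rw [residue] at h h'
  refine ⟨δ / β ^ m / (β ^ m / α ^ ⌊m * Real.logb (α : ℝ) β⌋ - c), ?_⟩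
  push_cast
  rw [coe_zpow_subfield, div_eq_iff h.ne', h']

theorem isCount_natCast (hα : 1 < (α : ℝ)) (hβ : 1 < (β : ℝ))
    (h : Irrational (Real.logb (α : ℝ) β)) (n : ℕ) :
    IsCount (integerPowers α) (integerPowers β) α β n := by
  intro ε hε
  have hε' : (0 : ℝ) < ε := by exact_mod_cast hε
  have hβ' : 1 < β := by exact_mod_cast hβ
  have hβ1 : β = β ^ 1 := (pow_one β).symm
  -- Consecutive values have product at most `(n + 4) ^ 2` and differ by at least `1 - ρ ≥ 1 / 2`,
  -- so this `ρ` gives `ρ * (v * v') ≤ ε * (v' - v)`.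
  obtain ⟨ρ, hρ, hρ1, hρε, hρn⟩ : ∃ ρ : ℝ, 0 < ρ ∧ ρ ≤ 1 / 2 ∧ ρ ≤ ε ∧
      ρ * (2 * ((n : ℝ) + 4) ^ 2) ≤ ε := by
    refine ⟨min (1 / 2) (min ε (ε / (2 * ((n : ℝ) + 4) ^ 2))), by positivity, min_le_left _ _,
      (min_le_right _ _).trans (min_le_left _ _), ?_⟩
    rw [← le_div_iff₀ (by positivity)]
    exact (min_le_right _ _).trans (min_le_right _ _)
  obtain ⟨δ, hδ, c, M, hM, hcode⟩ := exists_codesUpTo hα hβ h n hρ (by linarith)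
  have hδ' : (0 : ℝ) < ((δ : K) : ℝ) := by push_cast; exact_mod_cast hδ
  have hcode : CodesUpTo (α : ℝ) β ((δ : K) : ℝ) ρ n M ((c : K) : ℝ) := by
    push_cast; exact hcode
  refine ⟨δ, by exact_mod_cast hδ, c, β ^ M, ⟨M, by simp⟩,
    by simpa using pow_le_pow_right₀ hβ'.le hM, ?_, ?_, ?_⟩
  · obtain ⟨v, hv, h1, h2⟩ := hcode.first
    obtain ⟨v, rfl⟩ := hv.exists_coe hβ hδ'
    refine ⟨v, ?_, ?_, ?_⟩
    · conv => arg 5; rw [hβ1]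
      exact (attaches_pow_iff hα hβ _ _ _ _).2 hv
    · have : (2 : ℝ) - ε ≤ v := by linarith
      exact_mod_cast this
    · have : (v : ℝ) ≤ 2 + ε := by linarith
      exact_mod_cast this
  · obtain ⟨v, hv, h1, h2⟩ := hcode.last
    obtain ⟨v, rfl⟩ := hv.exists_coe hβ hδ'
    refine ⟨v, (attaches_pow_iff hα hβ _ _ _ _).2 hv, ?_, ?_⟩
    · have : (n : ℝ) + 2 - ε ≤ v := by linarith
      exact_mod_cast this
    · have : (v : ℝ) ≤ n + 2 + ε := by linarith
      exact_mod_cast this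
  · intro s s' v v' hs hs' hβs hss' hs'u hv hv' hbetween
    obtain ⟨j, hj, rfl⟩ := exists_nat_pow_of_le hβ hs hβs
    obtain ⟨m, hm, rfl⟩ := exists_nat_pow_of_le hβ hs' (hβs.trans hss'.le)
    rw [attaches_pow_iff hα hβ] at hv hv'
    rw [pow_lt_pow_iff_right₀ hβ'] at hss'
    rw [pow_le_pow_iff_right₀ hβ'] at hs'u
    obtain ⟨k, hk, h1, h2, h3, h4⟩ := hcode.step j m v v' hj hss' hs'u hv hv'
      fun r w hjr hrm hw => by
        obtain ⟨w, rfl⟩ := hw.exists_coe hβ hδ'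
        exact hbetween (β ^ r) w ⟨r, by simp⟩ (pow_lt_pow_right₀ hβ' hjr)
          (pow_lt_pow_right₀ hβ' hrm) ((attaches_pow_iff hα hβ _ _ _ _).2 hw)
    have hkn : (k : ℝ) + 1 ≤ n := by exact_mod_cast hk
    have hk0 : (0 : ℝ) ≤ k := k.cast_nonneg
    have hprod : (v : ℝ) * v' ≤ (n + 4) ^ 2 := by nlinarith
    have hprod0 : (0 : ℝ) < v * v' := by nlinarith
    have hbound : ρ * (v * v') ≤ ε * (v' - v) := by
      have : ρ * (v * v') ≤ ρ * (n + 4) ^ 2 := mul_le_mul_of_nonneg_left hprod hρ.le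
      nlinarith
    constructor
    · have : ((v' : ℝ) - v - 1) * (v * v') ≤ ε * (v' - v) := by nlinarith
      exact_mod_cast this
    · have : ((1 : ℝ) + v - v') * (v * v') ≤ ε * (v' - v) := by nlinarith
      exact_mod_cast this

theorem isCount_iff (hα : 1 < (α : ℝ)) (hβ : 1 < (β : ℝ))
    (h : Irrational (Real.logb (α : ℝ) β)) (x : K) :
    IsCount (integerPowers α) (integerPowers β) α β x ↔ ∃ n : ℕ, x = n := by
  refine ⟨fun hx => ?_, fun ⟨n, hn⟩ => hn ▸ isCount_natCast hα hβ h n⟩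
  have hcl : (x : ℝ) ∈ closure (Set.range ((↑) : ℕ → ℝ)) := by
    rw [Metric.mem_closure_iff]
    intro ε hε
    -- The tolerance must lie in `K`, hence a rational one.
    obtain ⟨q, hq0, hq⟩ := exists_rat_btwn (show (0 : ℝ) < ε / 3 by positivity)
    obtain ⟨δ, hδ, c, u, hc⟩ := hx q (by exact_mod_cast hq0)
    obtain ⟨n, hn⟩ := CountsTo.exists_nat hα hβ (by exact_mod_cast hq0) hδ hc
    push_cast at hn
    exact ⟨n, ⟨n, rfl⟩, by rw [Real.dist_eq]; linarith⟩
  rw [Nat.isClosedEmbedding_coe_real.isClosed_range.closure_eq] at hcl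
  obtain ⟨n, hn⟩ := hcl
  exact ⟨n, by exact_mod_cast hn.symm⟩

theorem defines_int_of_one_lt (hα : 1 < (α : ℝ)) (hβ : 1 < (β : ℝ))
    (h : Irrational (Real.logb (α : ℝ) β)) :
    Defines K (integerPowers α) (integerPowers β) (Set.range ((↑) : ℤ → K)) := by
  have hset : Set.range ((↑) : ℤ → K) = {x | IsCount (integerPowers α) (integerPowers β) α β x ∨
      ∃ y, x + y = 0 ∧ IsCount (integerPowers α) (integerPowers β) α β y} := by
    ext x
    simp only [Set.mem_ofPred_eq, isCount_iff hα hβ h]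
    constructor
    · rintro ⟨z, rfl⟩
      obtain ⟨n, rfl | rfl⟩ := z.eq_nat_or_neg
      · exact .inl ⟨n, by simp⟩
      · exact .inr ⟨n, by simp, n, rfl⟩
    · rintro (⟨n, rfl⟩ | ⟨y, hy, n, rfl⟩)
      · exact ⟨n, by simp⟩
      · exact ⟨-n, by rw [eq_neg_of_add_eq_zero_left hy]; simp⟩
  rw [hset]
  have hcount := isFormula_isCount (integerPowers α) (integerPowers β) α β
  refine IsFormula.defines (hcount.or (IsFormula.exists 1 ?_ fun _ _ _ => Iff.rfl))
  exact (IsFormula.eq ((IsTerm.var 0).add (.var 1)) (.const 0)).and (hcount.comp fun _ => 1)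

theorem integerPowers_inv (α : K) : integerPowers α⁻¹ = integerPowers α := by
  ext x
  constructor <;> rintro ⟨k, rfl⟩ <;> exact ⟨-k, by simp⟩

/-- One of `α`, `α⁻¹` is greater than `1`. -/
theorem exists_one_lt_integerPowers_eq (hα : 0 < α) (hα1 : α ≠ 1) :
    ∃ γ : K, 1 < (γ : ℝ) ∧ (γ = α ∨ γ = α⁻¹) ∧ integerPowers γ = integerPowers α := by
  rcases hα1.lt_or_gt with h | h
  · exact ⟨α⁻¹, by exact_mod_cast (one_lt_inv₀ hα).2 h, .inr rfl, integerPowers_inv α⟩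
  · exact ⟨α, by exact_mod_cast h, .inl rfl, rfl⟩

end Defining

end SubfieldExpansion

theorem theoremC (K : Subfield ℝ) (α β : K) (hα : 0 < α) (hβ : 0 < β)
    (h : Irrational (Real.logb (α : ℝ) (β : ℝ))) :
    SubfieldExpansion.Defines K (SubfieldExpansion.integerPowers α)
      (SubfieldExpansion.integerPowers β) (Set.range ((↑) : ℤ → K)) := by
  have hα1 : α ≠ 1 := by
    rintro rfl
    simp at h
  have hβ1 : β ≠ 1 := by
    rintro rfl
    simp at h
  obtain ⟨γ, hγ, hγα, hγeq⟩ := SubfieldExpansion.exists_one_lt_integerPowers_eq hα hα1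
  obtain ⟨η, hη, hηβ, hηeq⟩ := SubfieldExpansion.exists_one_lt_integerPowers_eq hβ hβ1
  rw [← hγeq, ← hηeq]
  refine SubfieldExpansion.defines_int_of_one_lt hγ hη ?_
  rcases hγα with rfl | rfl <;> rcases hηβ with rfl | rfl <;>
    simpa [Real.logb_inv, Real.logb_inv_base] using h
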